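/- Let $X$ be a random vector in $\mathbb{R}^n$ that satisfies the small-ball assumption with constant $\mathcal{L}\in\mathbb{R}$, that is, for every $1\le j\le n-1$, every $j$-dimensional linear subspace $F\subset\mathbb{R}^n$, every $z\in\mathbb{R}^n$ and every $\varepsilon>0$, $$\mathbb{P}\left(\|P_F X-z\|_2\le \varepsilon\sqrt{j}\right)\le(\mathcal{L}\varepsilon)^j,$$ where $P_F$ is the orthogonal projection of $\mathbb{R}^n$ onto $F$. Let $T:\mathbb{R}^n\to\mathbb{R}^m$ be a linear map with $\operatorname{rank}(T)=m$, and let $G$ be a standard Gaussian vector in $\mathbb{R}^n$. Then for every integer $k$ with $1\le k<m$, $$\mathbb{E}\left(\|TX\|_2^{-k}\right)\le\mathbb{E}\left(\left\|\frac{TG}{\sqrt{2\pi}\,\mathcal{L}}\right\|_2^{-k}\right),$$ where the expectations are taken in $[0,\infty]$, with $0^{-k}=\infty$. (If an integer $k$ with $1\le k<m$ exists then $n\ge2$, and the small-ball assumption forces $\mathcal{L}>0$.) -/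

import Mathlib

open MeasureTheory ProbabilityTheory

/-- The small-ball assumption with constant `L` for a random vector `X` in `ℝⁿ` defined on
`(Ω, P)`: for every `1 ≤ k ≤ n - 1`, every `k`-dimensional linear subspace `F` of `ℝⁿ`, every
`z ∈ ℝⁿ` and every `ε > 0`, `P (‖P_F X - z‖₂ ≤ ε √k) ≤ (L ε)ᵏ`, where `P_F` is the orthogonal
projection onto `F`, regarded as a map from `ℝⁿ` to `ℝⁿ`. -/
def SmallBallAssumption {Ω : Type*} [MeasurableSpace Ω] (P : Measure Ω) {n : ℕ}
    (X : Ω → EuclideanSpace ℝ (Fin n)) (L : ℝ) : Prop :=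
  ∀ k : ℕ, 1 ≤ k → k < n →
    ∀ F : Submodule ℝ (EuclideanSpace ℝ (Fin n)), Module.finrank ℝ F = k →
      ∀ z : EuclideanSpace ℝ (Fin n), ∀ ε : ℝ, 0 < ε →
        P.real {ω | ‖F.starProjection (X ω) - z‖ ≤ ε * √(k : ℝ)} ≤ (L * ε) ^ k

/-- The negative moment `𝔼 ‖W‖₂⁻ᵏ ∈ [0, ∞]` of a random vector `W` in `ℝᵐ` defined on `(Ω, P)`.
It is computed in the extended non-negative reals, so that `0⁻ᵏ = ∞` for `k ≥ 1`. -/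
noncomputable def negMoment {Ω : Type*} [MeasurableSpace Ω] (P : Measure Ω) {m : ℕ}
    (W : Ω → EuclideanSpace ℝ (Fin m)) (k : ℕ) : ENNReal :=
  ∫⁻ ω, (‖W ω‖ₑ ^ k)⁻¹ ∂P

/-!
For `y ≠ 0` and a matrix `A` with `k` independent standard Gaussian rows, `‖y‖⁻ᵏ` is, up to a
constant, the density at the origin of the Gaussian vector `A y`. Averaging over `y = T X` and
exchanging the two expectations turns `𝔼 ‖T X‖⁻ᵏ` into an average over `A` of the density at the
origin of the `k`-dimensional vector `A T X`. That density is governed by the law of the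
orthogonal projection of `X` onto a `k`-dimensional subspace `F` (the row space of `A T`). The
small-ball assumption bounds the density of `P_F X` by `Lᵏ` everywhere, whereas the density of
`P_F G / (√(2π) L)` is equal to `Lᵏ` at the origin. Hence the two negative moments compare.

Densities at the origin are probed with the Gaussian kernels
`K_δ (w, x) = δ^(-k/2) exp (-∑ i, ⟪w i, x⟫² / (2δ))` (`gaussKernel`) as `δ → 0`. Their average over
independent standard Gaussian vectors `w i` at a point `y` is exactly `(δ + ‖y‖²)^(-k/2)`
(`lintegral_gaussKernel_stdGaussian_pi`), which increases to `‖y‖⁻ᵏ`. The remaining ingredients are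

* `Measure.le_smul_of_forall_closedBall_le`: by the Besicovitch covering theorem, a measure that is
  dominated by a multiple of another one on balls is dominated on all measurable sets. Since a ball
  of radius `ε √k` in dimension `k` has volume at least `εᵏ`, the law of `P_F X` is at most `Lᵏ`
  times Lebesgue measure (`SmallBallAssumption.map_orthogonalProjectionOnto_le`);
* `lintegral_gaussKernel_le_liminf`: for fixed `w`, any `F` of dimension `k` that contains all `w i`
  bounds the kernel integral against the law of `X`, for every `δ`, by `Lᵏ J` with
  `J = ∫_F exp (-∑ i, ⟪w i, y⟫² / 2) dy`, and the kernel integral against the scaled Gaussian is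
  asymptotically at least `Lᵏ J`. The vectors `w i` need not be independent: if they are not, then
  `J = ∞` and the statement remains correct.
-/

open Module Filter Topology
open scoped ENNReal RealInnerProductSpace

/-! ### Domination of measures from domination on balls -/

/-- Domination `μ ≤ C • ν` can be tested on closed balls: by the Besicovitch covering theorem, a set
is covered by countably many balls whose `ν`-measures sum to little more than that of the set. -/
theorem MeasureTheory.Measure.le_smul_of_forall_closedBall_le {V : Type*} [MetricSpace V]
    [SecondCountableTopology V] [MeasurableSpace V] [OpensMeasurableSpace V]
    [HasBesicovitchCovering V] {μ ν : Measure V} [SFinite ν] [ν.OuterRegular] {C : ℝ≥0∞}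
    (hC : C ≠ ∞)
    (h : ∀ x : V, ∀ r : ℝ, 0 < r → μ (Metric.closedBall x r) ≤ C * ν (Metric.closedBall x r)) :
    μ ≤ C • ν := by
  refine Measure.le_iff.2 fun s _ => ?_
  have key : ∀ ε : ℝ≥0∞, ε ≠ 0 → μ s ≤ C * (ν s + ε) := by
    intro ε hε
    obtain ⟨t, r, ht, -, hr, hst, hsum⟩ :=
      Besicovitch.exists_closedBall_covering_tsum_measure_le ν hε (fun _ => Set.Ioi 0) s
        (fun x _ δ hδ => ⟨δ / 2, by simpa using hδ, by constructor <;> linarith⟩)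
    calc μ s ≤ μ (⋃ x ∈ t, Metric.closedBall x (r x)) := measure_mono hst
      _ ≤ ∑' x : t, μ (Metric.closedBall (x : V) (r x)) := measure_biUnion_le _ ht _
      _ ≤ ∑' x : t, C * ν (Metric.closedBall (x : V) (r x)) :=
        ENNReal.tsum_le_tsum fun x => h _ _ (hr _ x.2)
      _ = C * ∑' x : t, ν (Metric.closedBall (x : V) (r x)) := ENNReal.tsum_mul_left
      _ ≤ C * (ν s + ε) := by gcongr
  have hlim : Tendsto (fun ε : ℝ≥0∞ => C * (ν s + ε)) (𝓝[≠] 0) (𝓝 (C * (ν s + 0))) :=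
    (ENNReal.Tendsto.const_mul (tendsto_const_nhds.add tendsto_id) (Or.inr hC)).mono_left
      nhdsWithin_le_nhds
  rw [add_zero] at hlim
  exact ge_of_tendsto hlim (eventually_mem_nhdsWithin.mono key)

/-! ### Volume and Gaussian measure on Euclidean spaces -/

section InnerProductSpace

variable {V : Type*} [NormedAddCommGroup V] [InnerProductSpace ℝ V] [FiniteDimensional ℝ V]

theorem Submodule.exists_finrank_eq_of_le (W : Submodule ℝ V) {k : ℕ} (h : finrank ℝ W ≤ k)
    (hk : k ≤ finrank ℝ V) : ∃ U : Submodule ℝ V, W ≤ U ∧ finrank ℝ U = k := by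
  induction k, h using Nat.le_induction with
  | base => exact ⟨W, le_rfl, rfl⟩
  | succ k _ ih =>
    obtain ⟨U, hWU, hU⟩ := ih (by omega)
    have hne : U ≠ ⊤ := by
      rintro rfl
      rw [finrank_top] at hU
      omega
    obtain ⟨v, hv⟩ : ∃ v, v ∉ U := by
      by_contra! hall
      exact hne (eq_top_iff.2 fun v _ => hall v)
    refine ⟨U ⊔ ℝ ∙ v, hWU.trans le_sup_left, ?_⟩
    have := Submodule.finrank_sup_span_singleton hv
    omega

variable [MeasurableSpace V] [BorelSpace V]

/-- A ball of radius `ε √d` in dimension `d` contains a cube of side `ε` with a vertex at its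
centre. -/
theorem InnerProductSpace.ofReal_pow_finrank_le_volume_closedBall (z : V) {ε : ℝ} (hε : 0 < ε) :
    ENNReal.ofReal ε ^ finrank ℝ V ≤
      volume (Metric.closedBall z (ε * √(finrank ℝ V : ℝ))) := by
  set b := stdOrthonormalBasis ℝ V
  let S : Set (Fin (finrank ℝ V) → ℝ) :=
    Set.pi Set.univ fun i => Set.Icc (b.repr z i) (b.repr z i + ε)
  have hmp : MeasurePreserving (fun x => WithLp.ofLp (b.repr x)) (volume : Measure V) volume :=
    (PiLp.volume_preserving_ofLp _).comp b.measurePreserving_repr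
  have hS : volume S = ENNReal.ofReal ε ^ finrank ℝ V := by
    simp only [S, volume_pi_pi, Real.volume_Icc, add_sub_cancel_left, Finset.prod_const,
      Finset.card_univ, Fintype.card_fin]
  have hSm : MeasurableSet S := MeasurableSet.univ_pi fun i => measurableSet_Icc
  rw [← hS, ← hmp.measure_preimage hSm.nullMeasurableSet]
  refine measure_mono fun x hx => ?_
  rw [mem_closedBall_iff_norm, ← b.repr.norm_map, EuclideanSpace.norm_eq]
  refine Real.sqrt_le_iff.2 ⟨by positivity, ?_⟩
  rw [mul_pow, Real.sq_sqrt (by positivity)]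
  calc ∑ i, ‖(b.repr (x - z)) i‖ ^ 2 ≤ ∑ i : Fin (finrank ℝ V), ε ^ 2 := by
        refine Finset.sum_le_sum fun i _ => ?_
        have hi := hx i (Set.mem_univ i)
        simp only [Set.mem_Icc] at hi
        have e : b.repr (x - z) i = b.repr x i - b.repr z i := by simp
        rw [e, Real.norm_eq_abs, sq_abs]
        exact pow_le_pow_left₀ (by linarith) (by linarith) 2
    _ = ε ^ 2 * (finrank ℝ V : ℝ) := by simp [mul_comm]

theorem lintegral_comp_smul_mul_pow (f : V → ℝ≥0∞) (hf : Measurable f) {c : ℝ} (hc : 0 < c) :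
    ENNReal.ofReal c ^ finrank ℝ V * ∫⁻ y, f (c • y) = ∫⁻ y, f y := by
  have h := Measure.map_addHaar_smul (volume : Measure V) hc.ne'
  have h2 : ∫⁻ y, f (c • y) = ∫⁻ y, f y ∂(Measure.map (c • ·) (volume : Measure V)) :=
    (lintegral_map hf (measurable_const_smul c)).symm
  rw [h2, h, lintegral_smul_measure, smul_eq_mul, ← mul_assoc, ← ENNReal.ofReal_pow hc.le,
    ← ENNReal.ofReal_mul (by positivity), abs_of_pos (by positivity),
    mul_inv_cancel₀ (by positivity)]
  simp

/-- The Lebesgue density of the standard Gaussian measure, found by comparing characteristic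
functions. -/
theorem ProbabilityTheory.stdGaussian_eq_withDensity :
    stdGaussian V = (volume : Measure V).withDensity fun x =>
      ENNReal.ofReal ((√(2 * Real.pi))⁻¹ ^ finrank ℝ V * Real.exp (-‖x‖ ^ 2 / 2)) := by
  have hpos : (0 : ℝ) < 2 * Real.pi := by positivity
  have hint : Integrable (fun x : V => Real.exp (-‖x‖ ^ 2 / 2)) := by
    have h := GaussianFourier.integrable_cexp_neg_mul_sq_norm_add (V := V) (b := 1 / 2)
      (by norm_num) 0 0
    refine h.re.congr (.of_forall fun x => ?_)
    have e : -(1 / 2) * (‖x‖ : ℂ) ^ 2 + 0 * ((⟪(0 : V), x⟫ : ℝ) : ℂ) =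
        ((-‖x‖ ^ 2 / 2 : ℝ) : ℂ) := by push_cast; ring
    simp only [e, ← Complex.ofReal_exp, RCLike.re_to_complex, Complex.ofReal_re]
  have : IsFiniteMeasure ((volume : Measure V).withDensity fun x =>
      ENNReal.ofReal ((√(2 * Real.pi))⁻¹ ^ finrank ℝ V * Real.exp (-‖x‖ ^ 2 / 2))) :=
    isFiniteMeasure_withDensity_ofReal (hint.const_mul _).hasFiniteIntegral
  refine Measure.ext_of_charFun (funext fun t => ?_)
  rw [charFun_stdGaussian, charFun_apply,
    integral_withDensity_eq_integral_toReal_smul (by fun_prop) (by simp)]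
  have h := GaussianFourier.integral_cexp_neg_mul_sq_norm_add (V := V) (b := 1 / 2)
    (by norm_num) Complex.I t
  have hfun : ∀ x : V, (ENNReal.ofReal ((√(2 * Real.pi))⁻¹ ^ finrank ℝ V *
      Real.exp (-‖x‖ ^ 2 / 2))).toReal • Complex.exp (⟪x, t⟫ * Complex.I) =
      ((√(2 * Real.pi) : ℂ)⁻¹ ^ finrank ℝ V) *
        Complex.exp (-(1 / 2) * (‖x‖ : ℂ) ^ 2 + Complex.I * ⟪t, x⟫) := by
    intro x
    rw [ENNReal.toReal_ofReal (by positivity), Complex.real_smul, Complex.exp_add,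
      real_inner_comm t x]
    push_cast
    rw [mul_assoc]
    congr 3
    · ring
    · rw [mul_comm]
  have hc : ((Real.pi : ℂ) / (1 / 2)) ^ ((finrank ℝ V : ℂ) / 2) =
      (√(2 * Real.pi) : ℂ) ^ finrank ℝ V := by
    have e : (Real.pi : ℂ) / (1 / 2) = ((2 * Real.pi : ℝ) : ℂ) := by push_cast; ring
    have e2 : ((finrank ℝ V : ℂ) / 2) = (((finrank ℝ V : ℝ) / 2 : ℝ) : ℂ) := by push_cast; ring
    rw [e, e2, ← Complex.ofReal_cpow hpos.le, Real.sqrt_eq_rpow, ← Complex.ofReal_pow,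
      ← Real.rpow_natCast, ← Real.rpow_mul hpos.le]
    congr 2; ring
  simp_rw [hfun]
  rw [integral_const_mul, h, hc, ← mul_assoc, ← mul_pow, inv_mul_cancel₀
    (by exact_mod_cast (Real.sqrt_pos.2 hpos).ne'), one_pow, one_mul]
  congr 1
  rw [Complex.I_sq]
  ring

theorem ProbabilityTheory.stdGaussian_map_orthogonalProjectionOnto (F : Submodule ℝ V) :
    (stdGaussian V).map F.orthogonalProjectionOnto = stdGaussian F := by
  refine Measure.ext_of_charFun (funext fun t => ?_)
  rw [charFun_apply, integral_map (by fun_prop) (by fun_prop)]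
  have h := charFun_stdGaussian (t : V)
  rw [charFun_apply] at h
  simp_rw [real_inner_comm t, Submodule.inner_orthogonalProjectionOnto_eq_of_mem_left,
    real_inner_comm _ (t : V)]
  rw [h, charFun_stdGaussian, Submodule.coe_norm]

theorem ProbabilityTheory.stdGaussian_map_inner (y : V) :
    (stdGaussian V).map (fun a => ⟪a, y⟫) = (gaussianReal 0 1).map (fun x => ‖y‖ * x) := by
  have h := IsGaussian.map_eq_gaussianReal (μ := stdGaussian V) (innerSL ℝ y)
  rw [integral_strongDual_stdGaussian, variance_dual_stdGaussian, innerSL_apply_norm] at h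
  simp_rw [real_inner_comm y]
  rw [gaussianReal_map_const_mul, mul_zero, mul_one]
  refine h.trans ?_
  congr 1
  exact Real.toNNReal_of_nonneg (sq_nonneg _)

/-- The one-dimensional kernel average: up to the factor `√(2π)`, the density at the origin of
`⟪a, y⟫` plus an independent centred Gaussian of variance `δ`. -/
theorem lintegral_exp_neg_sq_inner_stdGaussian {δ : ℝ} (hδ : 0 < δ) (y : V) :
    ∫⁻ a, ENNReal.ofReal ((√δ)⁻¹ * Real.exp (-(⟪a, y⟫ ^ 2 / (2 * δ)))) ∂(stdGaussian V) =
      (ENNReal.ofReal √(δ + ‖y‖ ^ 2))⁻¹ := by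
  have hb : 0 < (δ + ‖y‖ ^ 2) / (2 * δ) := by positivity
  have hpi := Real.pi_pos
  have h1 : ∫⁻ a, ENNReal.ofReal ((√δ)⁻¹ * Real.exp (-(⟪a, y⟫ ^ 2 / (2 * δ)))) ∂(stdGaussian V) =
      ∫⁻ x, ENNReal.ofReal ((√δ)⁻¹ * Real.exp (-((‖y‖ * x) ^ 2 / (2 * δ)))) ∂gaussianReal 0 1 := by
    rw [← lintegral_map (μ := stdGaussian V) (g := fun a => ⟪a, y⟫)
      (f := fun x => ENNReal.ofReal ((√δ)⁻¹ * Real.exp (-(x ^ 2 / (2 * δ)))))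
      (by fun_prop) (by fun_prop), stdGaussian_map_inner,
      lintegral_map (by fun_prop) (by fun_prop)]
  -- The product of the Gaussian density and the kernel is again a centred Gaussian function.
  have h2 : ∀ x : ℝ, gaussianPDF 0 1 x *
      ENNReal.ofReal ((√δ)⁻¹ * Real.exp (-((‖y‖ * x) ^ 2 / (2 * δ)))) =
      ENNReal.ofReal ((√δ)⁻¹ * (√(2 * Real.pi))⁻¹ *
        Real.exp (-((δ + ‖y‖ ^ 2) / (2 * δ)) * x ^ 2)) := by
    intro x
    rw [gaussianPDF, ← ENNReal.ofReal_mul (gaussianPDFReal_nonneg _ _ _), gaussianPDFReal]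
    congr 1
    rw [show -((δ + ‖y‖ ^ 2) / (2 * δ)) * x ^ 2 =
      -(x - 0) ^ 2 / (2 * (1 : NNReal)) + -((‖y‖ * x) ^ 2 / (2 * δ)) by
        push_cast; field_simp; ring, Real.exp_add, NNReal.coe_one, mul_one]
    ring
  rw [h1, gaussianReal_of_var_ne_zero _ one_ne_zero,
    lintegral_withDensity_eq_lintegral_mul _ (measurable_gaussianPDF _ _) (by fun_prop)]
  simp only [Pi.mul_apply, h2]
  rw [← ofReal_integral_eq_lintegral_ofReal ((integrable_exp_neg_mul_sq hb).const_mul _)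
    (.of_forall fun x => by positivity), integral_const_mul, integral_gaussian,
    ← ENNReal.ofReal_inv_of_pos (by positivity)]
  congr 1
  rw [← Real.sqrt_inv, ← Real.sqrt_inv, ← Real.sqrt_inv, ← Real.sqrt_mul (by positivity),
    ← Real.sqrt_mul (by positivity)]
  congr 1
  field_simp

end InnerProductSpace

/-! ### Gaussian kernels -/

section Kernel

variable {V : Type*} [NormedAddCommGroup V] [InnerProductSpace ℝ V] {k : ℕ}

/-- The kernel `δ^(-k/2) exp (-∑ i, ⟪w i, x⟫² / (2δ))`, an approximate identity in the variable
`(⟪w i, x⟫)ᵢ ∈ ℝᵏ` as `δ → 0`. It omits the normalising factor `(2π)^(-k/2)`, and it is valued in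
`[0, ∞]` as it only occurs under lower integrals. -/
noncomputable def gaussKernel (δ : ℝ) (w : Fin k → V) (x : V) : ℝ≥0∞ :=
  ENNReal.ofReal ((√δ)⁻¹ ^ k * Real.exp (-((∑ i, ⟪w i, x⟫ ^ 2) / (2 * δ))))

theorem gaussKernel_eq_prod (δ : ℝ) (w : Fin k → V) (x : V) :
    gaussKernel δ w x =
      ∏ i, ENNReal.ofReal ((√δ)⁻¹ * Real.exp (-(⟪w i, x⟫ ^ 2 / (2 * δ)))) := by
  rw [gaussKernel, ← ENNReal.ofReal_prod_of_nonneg fun i _ => by positivity,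
    Finset.prod_mul_distrib, ← Real.exp_sum, Finset.sum_neg_distrib, Finset.sum_div]
  simp

/-- Scaling relates the kernel at scale `δ` to the kernel at scale `1`, which has no
normalisation. -/
theorem ofReal_pow_mul_gaussKernel_smul {δ : ℝ} (hδ : 0 < δ) (w : Fin k → V) (x : V) :
    ENNReal.ofReal √δ ^ k * gaussKernel δ w (√δ • x) = gaussKernel 1 w x := by
  have hs : 0 < √δ := Real.sqrt_pos.2 hδ
  rw [gaussKernel, gaussKernel, ← ENNReal.ofReal_pow hs.le, ← ENNReal.ofReal_mul (by positivity),
    ← mul_assoc, ← mul_pow, mul_inv_cancel₀ hs.ne']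
  simp only [inner_smul_right, mul_pow, Real.sq_sqrt hδ.le, ← Finset.mul_sum]
  congr 2
  · simp
  · congr 2
    field_simp

@[fun_prop]
theorem Measurable.gaussKernel [MeasurableSpace V] [BorelSpace V] [FiniteDimensional ℝ V]
    {α : Type*} [MeasurableSpace α] (δ : ℝ)
    {w : Fin k → α → V} {x : α → V} (hw : ∀ i, Measurable (w i)) (hx : Measurable x) :
    Measurable fun a => gaussKernel δ (fun i => w i a) (x a) := by
  unfold _root_.gaussKernel
  fun_prop

theorem gaussKernel_orthogonalProjectionOnto (F : Submodule ℝ V) [F.HasOrthogonalProjection]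
    (δ : ℝ) (w : Fin k → F) (x : V) :
    gaussKernel δ w (F.orthogonalProjectionOnto x) = gaussKernel δ (fun i => (w i : V)) x := by
  simp only [gaussKernel, Submodule.inner_orthogonalProjectionOnto_eq_of_mem_left]

variable [FiniteDimensional ℝ V] [MeasurableSpace V] [BorelSpace V]

/-- The average of the kernel over independent standard Gaussian vectors is a smoothed version of
`‖y‖⁻ᵏ`. This identity converts negative moments into small-scale behaviour of `k`-dimensional
marginals. -/
theorem lintegral_gaussKernel_stdGaussian_pi {δ : ℝ} (hδ : 0 < δ) (y : V) :
    ∫⁻ a, gaussKernel δ a y ∂(Measure.pi fun _ : Fin k => stdGaussian V) =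
      (ENNReal.ofReal √(δ + ‖y‖ ^ 2) ^ k)⁻¹ := by
  simp_rw [gaussKernel_eq_prod]
  rw [lintegral_prod_eq_prod_lintegral_of_indepFun Finset.univ
    (fun i (a : Fin k → V) => ENNReal.ofReal ((√δ)⁻¹ * Real.exp (-(⟪a i, y⟫ ^ 2 / (2 * δ)))))
    (iIndepFun_pi (X := fun _ (v : V) =>
      ENNReal.ofReal ((√δ)⁻¹ * Real.exp (-(⟪v, y⟫ ^ 2 / (2 * δ))))) fun i => by fun_prop)
    fun i => by fun_prop]
  rw [ENNReal.inv_pow, ← Finset.card_fin k, ← Finset.prod_const, Finset.card_fin]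
  refine Finset.prod_congr rfl fun i _ => ?_
  rw [← lintegral_exp_neg_sq_inner_stdGaussian hδ y,
    ← (measurePreserving_eval (fun _ : Fin k => stdGaussian V) i).lintegral_comp (by fun_prop)]

/-- A measure of density at most `C` on a `k`-dimensional space gives the kernel at most the mass it
has under `C` times Lebesgue measure, which does not depend on the scale `δ`. -/
theorem lintegral_gaussKernel_le_of_le_smul_volume {δ : ℝ} (hδ : 0 < δ) (hk : finrank ℝ V = k)
    {μ : Measure V} {C : ℝ≥0∞} (hμ : μ ≤ C • volume) (w : Fin k → V) :
    ∫⁻ y, gaussKernel δ w y ∂μ ≤ C * ∫⁻ y, gaussKernel 1 w y := by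
  refine (lintegral_mono' hμ le_rfl).trans_eq ?_
  rw [lintegral_smul_measure, smul_eq_mul,
    ← lintegral_comp_smul_mul_pow _ (by fun_prop) (Real.sqrt_pos.2 hδ), hk,
    ← lintegral_const_mul _ (by fun_prop)]
  simp_rw [ofReal_pow_mul_gaussKernel_smul hδ]

/-- The kernel integral against the law of `c G` on a `k`-dimensional space, rewritten by the
substitution `y ↦ (√δ / c) y`: as `δ → 0` the damping factor tends to `1`. -/
theorem lintegral_gaussKernel_smul_stdGaussian {δ c : ℝ} (hδ : 0 < δ) (hc : 0 < c)
    (hk : finrank ℝ V = k) (w : Fin k → V) :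
    ∫⁻ y, gaussKernel δ w (c • y) ∂(stdGaussian V) =
      ENNReal.ofReal ((√(2 * Real.pi) * c)⁻¹ ^ k) *
        ∫⁻ y, ENNReal.ofReal (Real.exp (-(δ * (‖y‖ ^ 2 / (2 * c ^ 2))))) * gaussKernel 1 w y := by
  have hs : 0 < √δ := Real.sqrt_pos.2 hδ
  rw [stdGaussian_eq_withDensity,
    lintegral_withDensity_eq_lintegral_mul _ (by fun_prop) (by fun_prop),
    ← lintegral_comp_smul_mul_pow _ (by fun_prop) (div_pos hs hc), hk,
    ← lintegral_const_mul _ (by fun_prop), ← lintegral_const_mul _ (by fun_prop)]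
  refine lintegral_congr fun y => ?_
  have e1 : c • (√δ / c) • y = √δ • y := by rw [smul_smul, mul_div_cancel₀ _ hc.ne']
  have e2 : -‖(√δ / c) • y‖ ^ 2 / 2 = -(δ * (‖y‖ ^ 2 / (2 * c ^ 2))) := by
    rw [norm_smul, Real.norm_of_nonneg (by positivity), mul_pow, div_pow, Real.sq_sqrt hδ.le]
    field_simp
  rw [Pi.mul_apply, e1, e2, ← ofReal_pow_mul_gaussKernel_smul hδ w y, div_eq_mul_inv,
    ENNReal.ofReal_mul hs.le, ENNReal.ofReal_mul (by positivity), mul_inv, mul_pow,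
    mul_pow, ENNReal.ofReal_mul (by positivity), ENNReal.ofReal_pow (inv_nonneg.2 hc.le)]
  ring

/-- In the limit `δ → 0`, the law of `c G` gives the kernel at least the mass it has under Lebesgue
measure times `(√(2π) c)⁻ᵏ`, the density of `c G` at the origin. -/
theorem smul_lintegral_gaussKernel_le_liminf {c : ℝ} (hc : 0 < c)
    (hk : finrank ℝ V = k) (w : Fin k → V) :
    ENNReal.ofReal ((√(2 * Real.pi) * c)⁻¹ ^ k) * ∫⁻ y, gaussKernel 1 w y ≤
      liminf (fun N : ℕ => ∫⁻ y, gaussKernel (1 / ((N : ℝ) + 1)) w (c • y) ∂(stdGaussian V))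
        atTop := by
  have hpos : ∀ N : ℕ, (0 : ℝ) < 1 / ((N : ℝ) + 1) := fun N => Nat.one_div_pos_of_nat
  have hm : ∀ N : ℕ, Measurable fun y : V => ENNReal.ofReal
      (Real.exp (-(1 / ((N : ℝ) + 1) * (‖y‖ ^ 2 / (2 * c ^ 2))))) * gaussKernel 1 w y :=
    fun N => by fun_prop
  rw [← lintegral_const_mul _ (by fun_prop)]
  simp_rw [fun N => (lintegral_gaussKernel_smul_stdGaussian (hpos N) hc hk w).trans
    (lintegral_const_mul _ (hm N)).symm]
  refine le_trans (lintegral_mono fun y => ?_)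
    (lintegral_liminf_le fun N => (hm N).const_mul _)
  refine (Tendsto.liminf_eq ?_).ge
  refine ENNReal.Tendsto.const_mul ?_ (Or.inr ENNReal.ofReal_ne_top)
  have h0 : Tendsto (fun N : ℕ => ENNReal.ofReal
      (Real.exp (-(1 / ((N : ℝ) + 1) * (‖y‖ ^ 2 / (2 * c ^ 2)))))) atTop (𝓝 1) := by
    have := (Real.continuous_exp.tendsto _).comp
      ((tendsto_one_div_add_atTop_nhds_zero_nat (𝕜 := ℝ)).mul_const (‖y‖ ^ 2 / (2 * c ^ 2))).neg
    simpa using ENNReal.tendsto_ofReal this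
  simpa using ENNReal.Tendsto.mul_const (b := gaussKernel 1 w y) h0 (Or.inl one_ne_zero)

end Kernel

/-! ### Consequences of the small-ball assumption -/

section SmallBall

variable {n : ℕ}

/-- If `L ≤ 0`, then every ball would be a null set for the projection of `X` onto a line. -/
theorem SmallBallAssumption.pos {Ω : Type*} [MeasurableSpace Ω] {P : Measure Ω}
    [IsProbabilityMeasure P] {X : Ω → EuclideanSpace ℝ (Fin n)} {L : ℝ}
    (h : SmallBallAssumption P X L) (hn : 1 < n) : 0 < L := by
  by_contra! hL
  obtain ⟨F, -, hF⟩ := Submodule.exists_finrank_eq_of_le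
    (⊥ : Submodule ℝ (EuclideanSpace ℝ (Fin n))) (k := 1) (by simp) (by simpa using hn.le)
  have hzero : ∀ N : ℕ, P {ω | ‖F.starProjection (X ω)‖ ≤ (N : ℝ) + 1} = 0 := by
    intro N
    have := h 1 le_rfl hn F hF 0 ((N : ℝ) + 1) (by positivity)
    simp only [sub_zero, Nat.cast_one, Real.sqrt_one, mul_one, pow_one] at this
    have h0 := this.trans (mul_nonpos_of_nonpos_of_nonneg hL (by positivity))
    exact (measureReal_eq_zero_iff).1 (le_antisymm h0 measureReal_nonneg)
  have hU : (⋃ N : ℕ, {ω | ‖F.starProjection (X ω)‖ ≤ (N : ℝ) + 1}) = Set.univ := by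
    refine Set.eq_univ_of_forall fun ω => Set.mem_iUnion.2 ?_
    obtain ⟨N, hN⟩ := exists_nat_ge ‖F.starProjection (X ω)‖
    exact ⟨N, hN.trans (by linarith)⟩
  have := measure_iUnion_null hzero
  rw [hU, measure_univ] at this
  exact one_ne_zero this

theorem SmallBallAssumption.map_orthogonalProjectionOnto_le {Ω : Type*} [MeasurableSpace Ω]
    {P : Measure Ω} [IsProbabilityMeasure P] {X : Ω → EuclideanSpace ℝ (Fin n)} {L : ℝ}
    (h : SmallBallAssumption P X L) (hX : AEMeasurable X P) (hL : 0 ≤ L) {k : ℕ} (hk : 1 ≤ k)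
    (hkn : k < n) (F : Submodule ℝ (EuclideanSpace ℝ (Fin n))) (hF : finrank ℝ F = k) :
    (P.map X).map F.orthogonalProjectionOnto ≤ ENNReal.ofReal (L ^ k) • volume := by
  refine Measure.le_smul_of_forall_closedBall_le ENNReal.ofReal_ne_top fun z r hr => ?_
  have hk0 : 0 < √(k : ℝ) := Real.sqrt_pos.2 (by exact_mod_cast hk)
  have hε : 0 < r / √(k : ℝ) := div_pos hr hk0
  have hvol := InnerProductSpace.ofReal_pow_finrank_le_volume_closedBall z hε
  have hsb := h k hk hkn F hF z _ hε
  rw [hF, div_mul_cancel₀ _ hk0.ne'] at hvol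
  rw [div_mul_cancel₀ _ hk0.ne'] at hsb
  rw [Measure.map_apply (by fun_prop) measurableSet_closedBall,
    Measure.map_apply_of_aemeasurable hX
      (measurableSet_closedBall.preimage (by fun_prop))]
  have hset : X ⁻¹' (F.orthogonalProjectionOnto ⁻¹' Metric.closedBall z r) =
      {ω | ‖F.starProjection (X ω) - z‖ ≤ r} := by
    ext ω
    rw [Set.mem_preimage, Set.mem_preimage, mem_closedBall_iff_norm, Submodule.coe_norm,
      Submodule.coe_sub, ← Submodule.starProjection_apply, Set.mem_ofPred_eq]
  rw [hset, ← ofReal_measureReal]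
  refine (ENNReal.ofReal_le_ofReal hsb).trans ?_
  rw [mul_pow, ENNReal.ofReal_mul (by positivity), ENNReal.ofReal_pow hε.le]
  gcongr

end SmallBall

/-! ### Negative moments as limits of smoothed moments -/

section Moments

variable {α W : Type*} [MeasurableSpace α] [NormedAddCommGroup W]

theorem lintegral_inv_norm_pow_le_of_forall [MeasurableSpace W] [BorelSpace W] {μ : Measure α}
    {f : α → W} (hf : Measurable f) (k : ℕ) {B : ℝ≥0∞}
    (h : ∀ δ : ℝ, 0 < δ → ∫⁻ x, (ENNReal.ofReal √(δ + ‖f x‖ ^ 2) ^ k)⁻¹ ∂μ ≤ B) :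
    ∫⁻ x, (‖f x‖ₑ ^ k)⁻¹ ∂μ ≤ B := by
  have hlim : ∀ x, Tendsto
      (fun N : ℕ => (ENNReal.ofReal √(1 / ((N : ℝ) + 1) + ‖f x‖ ^ 2) ^ k)⁻¹) atTop
      (𝓝 (‖f x‖ₑ ^ k)⁻¹) := by
    intro x
    have h := (Real.continuous_sqrt.tendsto _).comp
      ((tendsto_one_div_add_atTop_nhds_zero_nat (𝕜 := ℝ)).add_const (‖f x‖ ^ 2))
    rw [zero_add, Real.sqrt_sq (norm_nonneg _)] at h
    rw [← ofReal_norm]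
    exact tendsto_inv_iff.2 (ENNReal.Tendsto.pow (ENNReal.tendsto_ofReal h))
  calc ∫⁻ x, (‖f x‖ₑ ^ k)⁻¹ ∂μ
      = ∫⁻ x, liminf (fun N : ℕ =>
          (ENNReal.ofReal √(1 / ((N : ℝ) + 1) + ‖f x‖ ^ 2) ^ k)⁻¹) atTop ∂μ :=
        lintegral_congr fun x => (hlim x).liminf_eq.symm
    _ ≤ liminf (fun N : ℕ =>
          ∫⁻ x, (ENNReal.ofReal √(1 / ((N : ℝ) + 1) + ‖f x‖ ^ 2) ^ k)⁻¹ ∂μ) atTop :=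
        lintegral_liminf_le fun N => by fun_prop
    _ ≤ B := by
        refine liminf_le_of_le (by isBoundedDefault) fun b hb => ?_
        obtain ⟨N, hN⟩ := hb.exists
        exact hN.trans (h _ Nat.one_div_pos_of_nat)

theorem lintegral_inv_sqrt_pow_le (μ : Measure α) (f : α → W) (k : ℕ) {δ : ℝ} (hδ : 0 ≤ δ) :
    ∫⁻ x, (ENNReal.ofReal √(δ + ‖f x‖ ^ 2) ^ k)⁻¹ ∂μ ≤ ∫⁻ x, (‖f x‖ₑ ^ k)⁻¹ ∂μ := by
  refine lintegral_mono fun y => ENNReal.inv_le_inv.2 ?_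
  rw [← ofReal_norm]
  gcongr
  exact Real.le_sqrt_of_sq_le (by linarith)

end Moments

/-! ### Comparison of negative moments -/

/-- The comparison for fixed `w`: if the `k`-dimensional marginals of `μ` have densities bounded by
the density at the origin of the corresponding marginals of `c G`, then the kernel integrals of `μ`
at any scale are at most the small-scale limit of those of `c G`. -/
theorem lintegral_gaussKernel_le_liminf {V : Type*} [NormedAddCommGroup V]
    [InnerProductSpace ℝ V] [FiniteDimensional ℝ V] [MeasurableSpace V] [BorelSpace V]
    {μ : Measure V} {k : ℕ} {c : ℝ} (hc : 0 < c) (hk : k ≤ finrank ℝ V)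
    (hμ : ∀ F : Submodule ℝ V, finrank ℝ F = k →
      μ.map F.orthogonalProjectionOnto ≤ ENNReal.ofReal ((√(2 * Real.pi) * c)⁻¹ ^ k) • volume)
    {δ : ℝ} (hδ : 0 < δ) (w : Fin k → V) :
    ∫⁻ x, gaussKernel δ w x ∂μ ≤
      liminf (fun N : ℕ => ∫⁻ x, gaussKernel (1 / ((N : ℝ) + 1)) w (c • x) ∂(stdGaussian V))
        atTop := by
  obtain ⟨F, hwF, hF⟩ := Submodule.exists_finrank_eq_of_le (Submodule.span ℝ (Set.range w))
    ((finrank_range_le_card w).trans_eq (Fintype.card_fin k)) hk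
  -- The kernel depends on `x` only through its projection onto `F`.
  let w' : Fin k → F := fun i => ⟨w i, hwF (Submodule.subset_span ⟨i, rfl⟩)⟩
  have hproj : ∀ (η : ℝ) (x : V),
      gaussKernel η w x = gaussKernel η w' (F.orthogonalProjectionOnto x) :=
    fun η x => (gaussKernel_orthogonalProjectionOnto F η w' x).symm
  have hleft : ∫⁻ x, gaussKernel δ w x ∂μ =
      ∫⁻ y, gaussKernel δ w' y ∂(μ.map F.orthogonalProjectionOnto) := by
    rw [lintegral_map (by fun_prop) (by fun_prop)]
    simp_rw [hproj]
  have hright : ∀ N : ℕ, ∫⁻ x, gaussKernel (1 / ((N : ℝ) + 1)) w (c • x) ∂(stdGaussian V) =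
      ∫⁻ y, gaussKernel (1 / ((N : ℝ) + 1)) w' (c • y) ∂(stdGaussian F) := by
    intro N
    rw [← stdGaussian_map_orthogonalProjectionOnto, lintegral_map (by fun_prop) (by fun_prop)]
    simp_rw [hproj, map_smul]
  simp_rw [hright]
  rw [hleft]
  exact (lintegral_gaussKernel_le_of_le_smul_volume hδ hF (hμ F hF) w').trans
    (smul_lintegral_gaussKernel_le_liminf hc hF w')

/-- Comparison of negative moments with the Gaussian ones for measures whose `k`-dimensional
marginals have bounded densities: `lintegral_gaussKernel_le_liminf` is applied to the rows `T† aᵢ`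
of `A T` and averaged over Gaussian `aᵢ`. -/
theorem lintegral_inv_norm_pow_le_stdGaussian {V W : Type*} [NormedAddCommGroup V]
    [InnerProductSpace ℝ V] [FiniteDimensional ℝ V] [MeasurableSpace V] [BorelSpace V]
    [NormedAddCommGroup W] [InnerProductSpace ℝ W] [FiniteDimensional ℝ W] [MeasurableSpace W]
    [BorelSpace W] {μ : Measure V} [SFinite μ] {k : ℕ} {c : ℝ} (hc : 0 < c)
    (hk : k ≤ finrank ℝ V)
    (hμ : ∀ F : Submodule ℝ V, finrank ℝ F = k →
      μ.map F.orthogonalProjectionOnto ≤ ENNReal.ofReal ((√(2 * Real.pi) * c)⁻¹ ^ k) • volume)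
    (T : V →L[ℝ] W) :
    ∫⁻ x, (‖T x‖ₑ ^ k)⁻¹ ∂μ ≤ ∫⁻ x, (‖c • T x‖ₑ ^ k)⁻¹ ∂(stdGaussian V) := by
  have hpos : ∀ N : ℕ, (0 : ℝ) < 1 / ((N : ℝ) + 1) := fun N => Nat.one_div_pos_of_nat
  set γ : Measure (Fin k → W) := Measure.pi fun _ => stdGaussian W with hγ
  -- Averaging the kernel over Gaussian rows, with Tonelli's theorem. The factor `b` is `1` for `μ`
  -- and `c` for the Gaussian measure.
  have hswap : ∀ (ν : Measure V) [SFinite ν] (b : ℝ) {δ : ℝ}, 0 < δ →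
      ∫⁻ x, (ENNReal.ofReal √(δ + ‖b • T x‖ ^ 2) ^ k)⁻¹ ∂ν =
        ∫⁻ a, ∫⁻ x, gaussKernel δ (fun i => T.adjoint (a i)) (b • x) ∂ν ∂γ := by
    intro ν _ b δ hδ
    rw [← lintegral_lintegral_swap (by fun_prop)]
    refine lintegral_congr fun x => ?_
    rw [← lintegral_gaussKernel_stdGaussian_pi hδ]
    refine lintegral_congr fun a => ?_
    simp only [gaussKernel, ContinuousLinearMap.adjoint_inner_left, map_smul]
  refine lintegral_inv_norm_pow_le_of_forall T.measurable k fun δ hδ => ?_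
  calc ∫⁻ x, (ENNReal.ofReal √(δ + ‖T x‖ ^ 2) ^ k)⁻¹ ∂μ
      = ∫⁻ a, ∫⁻ x, gaussKernel δ (fun i => T.adjoint (a i)) x ∂μ ∂γ := by
        simpa using hswap μ 1 hδ
    _ ≤ ∫⁻ a, liminf (fun N : ℕ => ∫⁻ x, gaussKernel (1 / ((N : ℝ) + 1))
          (fun i => T.adjoint (a i)) (c • x) ∂(stdGaussian V)) atTop ∂γ :=
        lintegral_mono fun a => lintegral_gaussKernel_le_liminf hc hk hμ hδ _
    _ ≤ liminf (fun N : ℕ => ∫⁻ a, ∫⁻ x, gaussKernel (1 / ((N : ℝ) + 1))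
          (fun i => T.adjoint (a i)) (c • x) ∂(stdGaussian V) ∂γ) atTop :=
        lintegral_liminf_le fun N => Measurable.lintegral_prod_right (by fun_prop)
    _ ≤ ∫⁻ x, (‖c • T x‖ₑ ^ k)⁻¹ ∂(stdGaussian V) := by
        simp_rw [← fun N => hswap (stdGaussian V) c (hpos N)]
        refine liminf_le_of_le (by isBoundedDefault) fun b hb => ?_
        obtain ⟨N, hN⟩ := hb.exists
        exact hN.trans (lintegral_inv_sqrt_pow_le _ _ _ (hpos N).le)

theorem theorem1p5 {Ω Ω' : Type*} [MeasurableSpace Ω] [MeasurableSpace Ω']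
    (P : Measure Ω) [IsProbabilityMeasure P] (P' : Measure Ω') [IsProbabilityMeasure P']
    (n m : ℕ) (L : ℝ)
    (X : Ω → EuclideanSpace ℝ (Fin n)) (hX : AEMeasurable X P)
    (hSBA : SmallBallAssumption P X L)
    (T : EuclideanSpace ℝ (Fin n) →ₗ[ℝ] EuclideanSpace ℝ (Fin m))
    (hT : Module.finrank ℝ (LinearMap.range T) = m)
    (G : Ω' → EuclideanSpace ℝ (Fin n))
    (hG : HasLaw G (stdGaussian (EuclideanSpace ℝ (Fin n))) P')
    (k : ℕ) (hk : 1 ≤ k) (hkm : k < m) :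
    negMoment P (fun ω => T (X ω)) k ≤
      negMoment P' (fun ω => (1 / (√(2 * Real.pi) * L)) • T (G ω)) k := by
  have hmn : m ≤ n := by
    have h := LinearMap.finrank_range_le T
    rwa [hT, finrank_euclideanSpace_fin] at h
  have hL : 0 < L := hSBA.pos (by omega)
  have hpi : 0 < √(2 * Real.pi) := Real.sqrt_pos.2 (by positivity)
  have : IsProbabilityMeasure (P.map X) := Measure.isProbabilityMeasure_map hX
  have hT' : Measurable T := (LinearMap.toContinuousLinearMap T).measurable
  -- With this `c`, the density `(√(2π) c)⁻ᵏ` of `c G` at the origin is exactly `Lᵏ`.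
  have h := lintegral_inv_norm_pow_le_stdGaussian (μ := P.map X) (k := k)
    (c := 1 / (√(2 * Real.pi) * L)) (by positivity)
    (by rw [finrank_euclideanSpace_fin]; omega)
    (fun F hF => by
      have e : (√(2 * Real.pi) * (1 / (√(2 * Real.pi) * L)))⁻¹ = L := by field_simp
      rw [e]
      exact hSBA.map_orthogonalProjectionOnto_le hX hL.le hk (by omega) F hF)
    (LinearMap.toContinuousLinearMap T)
  simp only [LinearMap.coe_toContinuousLinearMap'] at h
  rw [lintegral_map' (by fun_prop) hX, ← hG.map_eq,
    lintegral_map' (by fun_prop) hG.aemeasurable] at h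
  exact h
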